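/- **Theorem.** Let $t\ge 3$ be a fixed integer. There are a constant $C=C_t$, a polynomial $p=p_t$ and a deterministic algorithm (a program of a random access machine over $\mathbb{N}$ whose elementary instructions are assignment, addition, truncated subtraction, array access and comparison, each counted as one step), all depending only on $t$, such that for all integers $r\ge 1$ and $q\ge C(r+1)^2$ the following holds. Put $$m=\left\lceil\frac{q^{1+\frac{1}{t-1}}}{2t^2(r+1)^{2+\frac{2}{t-1}}}\right\rceil .$$ On input $(q,r)$ the algorithm halts after at most $p(q)$ steps and outputs exactly $m$ sets $A_1,\dots,A_m\subseteq\{1,\dots,q\}$ such that $|A_i|=r+1$ for $1\le i\le m$, and $$\Bigl|\bigcup_{i\in S}A_i\Bigr|\ge |S|\,r+1\qquad\text{for every nonempty } S\subseteq\{1,\dots,m\}\text{ with } |S|\le t .$$ -/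

import Mathlib

namespace RAM

/-- Programs of a deterministic random access machine over the natural numbers. A program refers to
finitely many variables `0, 1, 2, …` and finitely many unbounded arrays `0, 1, 2, …`. The only
arithmetic is addition and truncated subtraction, so (literals aside) one step at most doubles the largest number
occurring in the computation, and counting steps at unit cost is polynomially equivalent to counting
the steps of a Turing machine. -/
inductive Prog : Type
  /-- do nothing -/
  | skip : Prog
  /-- `x := c` for a literal `c` -/
  | const (x c : ℕ) : Prog
  /-- `x := y + z` -/
  | add (x y z : ℕ) : Prog
  /-- `x := y - z`, truncated at `0` -/
  | sub (x y z : ℕ) : Prog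
  /-- `x := a[y]` -/
  | load (x a y : ℕ) : Prog
  /-- `a[x] := y` -/
  | store (a x y : ℕ) : Prog
  /-- run `P`, then `Q` -/
  | seq (P Q : Prog) : Prog
  /-- `if x < y then P else Q` -/
  | ite (x y : ℕ) (P Q : Prog) : Prog
  /-- `while x < y do P` -/
  | loop (x y : ℕ) (P : Prog) : Prog

/-- The memory: the values of the variables and the contents of the arrays. -/
@[ext]
structure Store : Type where
  var : ℕ → ℕ
  arr : ℕ → ℕ → ℕ

namespace Store

/-- Overwrite variable `x` by `v`. -/
def setVar (s : Store) (x v : ℕ) : Store :=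
  { s with var := Function.update s.var x v }

/-- Overwrite cell `i` of array `a` by `v`. -/
def setArr (s : Store) (a i v : ℕ) : Store :=
  { s with arr := Function.update s.arr a (Function.update (s.arr a) i v) }

end Store

open Prog in
/-- `Runs P s s' n`: started in memory `s`, the program `P` halts in memory `s'` after exactly `n`
steps, where every elementary instruction and every evaluation of a test is one step. -/
inductive Runs : Prog → Store → Store → ℕ → Prop
  | skip (s : Store) : Runs skip s s 1
  | const (s : Store) (x c : ℕ) : Runs (const x c) s (s.setVar x c) 1
  | add (s : Store) (x y z : ℕ) : Runs (add x y z) s (s.setVar x (s.var y + s.var z)) 1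
  | sub (s : Store) (x y z : ℕ) : Runs (sub x y z) s (s.setVar x (s.var y - s.var z)) 1
  | load (s : Store) (x a y : ℕ) : Runs (load x a y) s (s.setVar x (s.arr a (s.var y))) 1
  | store (s : Store) (a x y : ℕ) : Runs (store a x y) s (s.setArr a (s.var x) (s.var y)) 1
  | seq {P Q : Prog} {s s₁ s₂ : Store} {n₁ n₂ : ℕ} :
      Runs P s s₁ n₁ → Runs Q s₁ s₂ n₂ → Runs (seq P Q) s s₂ (n₁ + n₂)
  | iteTrue {x y : ℕ} {P Q : Prog} {s s₁ : Store} {n : ℕ} :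
      s.var x < s.var y → Runs P s s₁ n → Runs (ite x y P Q) s s₁ (n + 1)
  | iteFalse {x y : ℕ} {P Q : Prog} {s s₁ : Store} {n : ℕ} :
      ¬ s.var x < s.var y → Runs Q s s₁ n → Runs (ite x y P Q) s s₁ (n + 1)
  | loopTrue {x y : ℕ} {P : Prog} {s s₁ s₂ : Store} {n₁ n₂ : ℕ} :
      s.var x < s.var y → Runs P s s₁ n₁ → Runs (loop x y P) s₁ s₂ n₂ →
      Runs (loop x y P) s s₂ (n₁ + n₂ + 1)
  | loopFalse {x y : ℕ} {P : Prog} {s : Store} :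
      ¬ s.var x < s.var y → Runs (loop x y P) s s 1

/-- The machine is deterministic: memory at halting and number of steps are determined by the
program and the initial memory. -/
theorem Runs.deterministic {P : Prog} {s s₁ s₂ : Store} {n₁ n₂ : ℕ}
    (h₁ : Runs P s s₁ n₁) (h₂ : Runs P s s₂ n₂) : s₁ = s₂ ∧ n₁ = n₂ := by
  induction h₁ generalizing s₂ n₂ with
  | skip | const | add | sub | load | store => cases h₂; exact ⟨rfl, rfl⟩
  | seq _ _ ih₁ ih₂ =>
    cases h₂ with
    | seq k₁ k₂ =>
      obtain ⟨rfl, rfl⟩ := ih₁ k₁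
      obtain ⟨rfl, rfl⟩ := ih₂ k₂
      exact ⟨rfl, rfl⟩
  | iteTrue h _ ih =>
    cases h₂ with
    | iteTrue _ k => obtain ⟨rfl, rfl⟩ := ih k; exact ⟨rfl, rfl⟩
    | iteFalse h' _ => exact absurd h h'
  | iteFalse h _ ih =>
    cases h₂ with
    | iteTrue h' _ => exact absurd h' h
    | iteFalse _ k => obtain ⟨rfl, rfl⟩ := ih k; exact ⟨rfl, rfl⟩
  | loopTrue h _ _ ih₁ ih₂ =>
    cases h₂ with
    | loopTrue _ k₁ k₂ =>
      obtain ⟨rfl, rfl⟩ := ih₁ k₁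
      obtain ⟨rfl, rfl⟩ := ih₂ k₂
      exact ⟨rfl, rfl⟩
    | loopFalse h' => exact absurd h h'
  | loopFalse h =>
    cases h₂ with
    | loopTrue h' _ _ => exact absurd h' h
    | loopFalse _ => exact ⟨rfl, rfl⟩

/-- The initial memory on input `(q, r)`: variable `0` holds `q`, variable `1` holds `r`, and all
other variables and all array cells are `0`. -/
def input (q r : ℕ) : Store where
  var := fun x => if x = 0 then q else if x = 1 then r else 0
  arr := fun _ _ => 0

/-- The output convention for a sequence of sets of size `k`: the number of sets is in variable `0`,
and the elements of the `i`-th set (`i = 0, 1, …`) are in the cells `i * k, …, i * k + (k - 1)` of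
array `0`. -/
def outputSet (s : Store) (k i : ℕ) : Finset ℕ :=
  (Finset.range k).image fun j => s.arr 0 (i * k + j)

end RAM

/-- The number `⌈q ^ (1 + 1 / (t - 1)) / (2 t ^ 2 (r + 1) ^ (2 + 2 / (t - 1)))⌉` of sets. -/
noncomputable def numSets (t r q : ℕ) : ℕ :=
  ⌈(q : ℝ) ^ (1 + 1 / ((t : ℝ) - 1)) /
    (2 * (t : ℝ) ^ 2 * ((r : ℝ) + 1) ^ (2 + 2 / ((t : ℝ) - 1)))⌉₊

/-- `A₁, …, A_m` are subsets of `{1, …, q}` of size `r + 1` such that the union of any `a` of them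
with `1 ≤ a ≤ t` has at least `a * r + 1` elements. -/
structure IsGoodFamily (t r q m : ℕ) (A : Fin m → Finset ℕ) : Prop where
  subset : ∀ i, A i ⊆ Finset.Icc 1 q
  card : ∀ i, (A i).card = r + 1
  union : ∀ S : Finset (Fin m), S.Nonempty → S.card ≤ t → S.card * r + 1 ≤ (S.biUnion A).card

/-!
The family is found greedily. Put `k = r + 1`, and call a set of blocks of length `k` sparse if the
union of any `a ≤ t` of its blocks, `a ≥ 1`, has at least `a * r + 1` elements. The algorithm
writes the elements of the blocks one by one. An element `v` may be appended to the current block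
if it has fewer than `2 * m * k / q` occurrences so far and if no walk of at most `t - 1` steps
through the completed blocks joins it to an element of the current block (`Greedy.Admissible`).

*Sparseness* (`Greedy.le_card_biUnion_block`). Among `a ≤ t` blocks take the last one, and split
the others into connected components. A component contains at most one element of the last block,
since two elements of a component are joined by a walk with at most as many steps as it has blocks.
By induction a component of `c` blocks has at least `c * r + 1` elements, hence at least `c * r`
outside the last block; so the union has at least `(a - 1) * r + (r + 1)` elements.

*An admissible element exists* (`Greedy.exists_admissible`). Counting occurrences shows that more
than `q / 2` elements are unsaturated. If `2 * m * k ≤ q`, these do not occur at all, and each of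
the at most `r` elements of the current block excludes only itself. Otherwise no element occurs
more than `D = ⌊2 * m * k / q⌋ + 1` times, so each element of the current block excludes at most
`(D * k) ^ (t - 1)` elements, and by the choice of `m` this is less than `q / (2 * k)`.

*Running time.* A bounded sum of polynomial-time computable expressions is again one
(`RAM.Comp.sum`, proved with an explicit loop). Together with addition, truncated subtraction and
array access, bounded sums give products, comparisons, quotients, bounded quantifiers and bounded
search. Since `t` is fixed, admissibility is expressible in this way, and so is `m`: the comparison
`c < m` is one between integers after raising to the power `t - 1` (`Greedy.lt_numSets_iff`). Only
the loop that fills the array is then written by hand (`Greedy.exists_prog_build`).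
-/

/-! ### Programs that evaluate expressions in polynomial time -/

namespace RAM

open Finset Prog

/-- The rule for loops that run a known number `N` of times: `I i` describes the memory after `i`
rounds, and `T` bounds the time of one round. -/
theorem exists_runs_loop {x y : ℕ} {P : Prog} (I : ℕ → Store → Prop) (N T : ℕ)
    (hstep : ∀ i < N, ∀ s, I i s → s.var x < s.var y ∧
      ∃ s' n, Runs P s s' n ∧ n ≤ T ∧ I (i + 1) s')
    (hend : ∀ s, I N s → ¬ s.var x < s.var y) (s : Store) (hs : I 0 s) :
    ∃ s' n, Runs (loop x y P) s s' n ∧ n ≤ N * (T + 1) + 1 ∧ I N s' := by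
  suffices h : ∀ d i, i + d = N → ∀ s, I i s →
      ∃ s' n, Runs (loop x y P) s s' n ∧ n ≤ d * (T + 1) + 1 ∧ I N s' from
    h N 0 (by simp) s hs
  intro d
  induction d with
  | zero =>
    rintro i rfl s hs
    exact ⟨s, 1, .loopFalse (hend s hs), by simp, hs⟩
  | succ d ih =>
    intro i hi s hs
    obtain ⟨hlt, s₁, n₁, hr₁, hn₁, hI₁⟩ := hstep i (by omega) s hs
    obtain ⟨s₂, n₂, hr₂, hn₂, hI₂⟩ := ih (i + 1) (by omega) s₁ hI₁
    exact ⟨s₂, _, .loopTrue hlt hr₁ hr₂, by linarith, hI₂⟩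

/-- `f a v` is the value of an expression in the array `a` and the variables `v 0, v 1, …`. The
predicate says that a program can evaluate the expression in time polynomial in a bound on its
arguments, whatever variables `ρ 0, ρ 1, …` of the machine hold `v`, leaving the arrays and all
variables below `b` untouched and putting the result into variable `b`; and that the result is
polynomially bounded. -/
def Comp (f : (ℕ → ℕ) → (ℕ → ℕ) → ℕ) : Prop :=
  ∀ (ρ : ℕ → ℕ) (b : ℕ), (∀ x, ρ x < b) → ∃ (P : Prog) (p : Polynomial ℕ),
    ∀ (s : Store) (X : ℕ), (∀ i, s.arr 0 i ≤ X) → (∀ x, s.var (ρ x) ≤ X) →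
      f (s.arr 0) (fun x => s.var (ρ x)) ≤ p.eval X ∧
      ∃ s' n, Runs P s s' n ∧ n ≤ p.eval X ∧ s'.arr = s.arr ∧
        s'.var b = f (s.arr 0) (fun x => s.var (ρ x)) ∧ ∀ y < b, s'.var y = s.var y

namespace Comp

variable {f g : (ℕ → ℕ) → (ℕ → ℕ) → ℕ}

theorem const (c : ℕ) : Comp fun _ _ => c := by
  intro ρ b _
  refine ⟨.const b c, Polynomial.C (c + 1), fun s X _ _ => ⟨by simp, _, _, .const s b c, ?_⟩⟩
  simp only [Polynomial.eval_C, Store.setVar, Function.update_self, true_and]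
  exact ⟨by omega, fun y hy => Function.update_of_ne hy.ne _ _⟩

theorem var (i : ℕ) : Comp fun _ v => v i := by
  intro ρ b hρ
  refine ⟨.seq (.const b 0) (.add b (ρ i) b), Polynomial.X + 2, fun s X _ hv =>
    ⟨by simpa using Nat.le_add_right_of_le (hv i), _, _, .seq (.const s b 0) (.add _ _ _ _), ?_⟩⟩
  simp only [Polynomial.eval_add, Polynomial.eval_X, Polynomial.eval_ofNat, Store.setVar,
    Function.update_self, Function.update_of_ne (hρ i).ne, true_and, add_zero]
  exact ⟨by omega, fun y hy => by simp [hy.ne]⟩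

theorem rename (hf : Comp f) (σ : ℕ → ℕ) : Comp fun a v => f a fun x => v (σ x) := by
  intro ρ b hρ
  obtain ⟨P, p, hP⟩ := hf (fun x => ρ (σ x)) b fun x => hρ (σ x)
  exact ⟨P, p, fun s X ha hv => hP s X ha fun x => hv (σ x)⟩

theorem weaken (hf : Comp f) : Comp fun a v => f a fun x => v (x + 1) :=
  hf.rename Nat.succ

theorem read (hf : Comp f) : Comp fun a v => a (f a v) := by
  intro ρ b hρ
  obtain ⟨P, p, hP⟩ := hf ρ b hρ
  refine ⟨.seq P (.load b 0 b), p + Polynomial.X + 1, fun s X ha hv => ?_⟩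
  obtain ⟨_, s₁, n₁, hr₁, hn₁, harr, hb, hy⟩ := hP s X ha hv
  simp only [Polynomial.eval_add, Polynomial.eval_X, Polynomial.eval_one]
  refine ⟨(ha _).trans (by omega), _, _, .seq hr₁ (.load _ _ _ _), by omega, harr, ?_,
    fun y hyb => ?_⟩
  · simp [Store.setVar, harr, hb]
  · simp [Store.setVar, hyb.ne, hy y hyb]

/-- Evaluation of two expressions one after the other, into the variables `b` and `b + 1`. -/
theorem pair (hf : Comp f) (hg : Comp g) {ρ : ℕ → ℕ} {b : ℕ} (hρ : ∀ x, ρ x < b) :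
    ∃ (P : Prog) (p : Polynomial ℕ), ∀ (s : Store) (X : ℕ), (∀ i, s.arr 0 i ≤ X) →
      (∀ x, s.var (ρ x) ≤ X) →
      f (s.arr 0) (fun x => s.var (ρ x)) + g (s.arr 0) (fun x => s.var (ρ x)) ≤ p.eval X ∧
      ∃ s' n, Runs P s s' n ∧ n ≤ p.eval X ∧ s'.arr = s.arr ∧
        s'.var b = f (s.arr 0) (fun x => s.var (ρ x)) ∧
        s'.var (b + 1) = g (s.arr 0) (fun x => s.var (ρ x)) ∧ ∀ y < b, s'.var y = s.var y := by
  obtain ⟨P, p, hP⟩ := hf ρ b hρ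
  obtain ⟨Q, q, hQ⟩ := hg ρ (b + 1) fun x => (hρ x).trans (Nat.lt_succ_self b)
  refine ⟨.seq P Q, p + q, fun s X ha hv => ?_⟩
  obtain ⟨hfb, s₁, n₁, hr₁, hn₁, harr₁, hb₁, hy₁⟩ := hP s X ha hv
  have hv₁ : (fun x => s₁.var (ρ x)) = fun x => s.var (ρ x) := funext fun x => hy₁ _ (hρ x)
  obtain ⟨hgb, s₂, n₂, hr₂, hn₂, harr₂, hb₂, hy₂⟩ := hQ s₁ X (by rwa [harr₁])
    (fun x => (congrFun hv₁ x).trans_le (hv x))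
  rw [hv₁, harr₁] at hgb hb₂
  simp only [Polynomial.eval_add]
  exact ⟨by omega, s₂, _, .seq hr₁ hr₂, by omega, harr₂.trans harr₁,
    (hy₂ b (by omega)).trans hb₁, hb₂, fun y hy => (hy₂ y (by omega)).trans (hy₁ y hy)⟩

theorem add (hf : Comp f) (hg : Comp g) : Comp fun a v => f a v + g a v := by
  intro ρ b hρ
  obtain ⟨P, p, hP⟩ := hf.pair hg hρ
  refine ⟨.seq P (.add b b (b + 1)), p + 1, fun s X ha hv => ?_⟩
  obtain ⟨hle, s₁, n₁, hr₁, hn₁, harr, hb, hb', hy⟩ := hP s X ha hv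
  simp only [Polynomial.eval_add, Polynomial.eval_one]
  refine ⟨by omega, _, _, .seq hr₁ (.add _ _ _ _), by omega, harr, ?_, fun y hyb => ?_⟩
  · simp [Store.setVar, hb, hb']
  · simp [Store.setVar, hyb.ne, hy y hyb]

theorem sub (hf : Comp f) (hg : Comp g) : Comp fun a v => f a v - g a v := by
  intro ρ b hρ
  obtain ⟨P, p, hP⟩ := hf.pair hg hρ
  refine ⟨.seq P (.sub b b (b + 1)), p + 1, fun s X ha hv => ?_⟩
  obtain ⟨hle, s₁, n₁, hr₁, hn₁, harr, hb, hb', hy⟩ := hP s X ha hv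
  simp only [Polynomial.eval_add, Polynomial.eval_one]
  refine ⟨by omega, _, _, .seq hr₁ (.sub _ _ _ _), by omega, harr, ?_, fun y hyb => ?_⟩
  · simp [Store.setVar, hb, hb']
  · simp [Store.setVar, hyb.ne, hy y hyb]

/-- Bounded sums. The summation index becomes variable `0` of the summand, and the variables of the
context move up by one. -/
theorem sum {g : (ℕ → ℕ) → (ℕ → ℕ) → ℕ → ℕ} (hf : Comp f)
    (hg : Comp fun a v => g a (fun x => v (x + 1)) (v 0)) :
    Comp fun a v => ∑ j ∈ range (f a v), g a v j := by
  intro ρ b hρ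
  -- The variables are: `b` the number of rounds, `b + 1` the partial sum, `b + 2` the index,
  -- `b + 3` the literal `1`, and `b + 4` the current summand.
  obtain ⟨P, p, hP⟩ := hf ρ b hρ
  let ρ' : ℕ → ℕ := fun x => Nat.casesOn x (b + 2) ρ
  obtain ⟨Q, q, hQ⟩ := hg ρ' (b + 4) (by
    rintro (_ | x)
    · change b + 2 < b + 4; omega
    · exact (hρ x).trans (by omega))
  refine ⟨.seq P (.seq (.const (b + 1) 0) (.seq (.const (b + 2) 0) (.seq (.const (b + 3) 1)
    (.seq (.loop (b + 2) b (.seq Q (.seq (.add (b + 1) (b + 1) (b + 4))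
      (.add (b + 2) (b + 2) (b + 3)))))
    (.seq (.const (b + 2) 0) (.add b (b + 1) (b + 2))))))),
    p + p * (q.comp (Polynomial.X + p) + 3) + 6, fun s X ha hv => ?_⟩
  obtain ⟨hfb, s₁, n₁, hr₁, hn₁, harr₁, hb₁, hy₁⟩ := hP s X ha hv
  set F := f (s.arr 0) (fun x => s.var (ρ x)) with hF
  set G := g (s.arr 0) (fun x => s.var (ρ x)) with hG
  set T := q.eval (X + p.eval X) with hT
  -- One evaluation of the summand, from any memory in which the index is `j`.
  have key : ∀ j < F, ∀ u : Store, u.arr = s.arr → (∀ y < b, u.var y = s.var y) →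
      u.var (b + 2) = j → G j ≤ T ∧ ∃ u' n, Runs Q u u' n ∧ n ≤ T ∧ u'.arr = u.arr ∧
        u'.var (b + 4) = G j ∧ ∀ y < b + 4, u'.var y = u.var y := by
    intro j hj u harr hu hi
    have := hQ u (X + p.eval X) (fun i => by rw [harr]; exact (ha i).trans (by omega)) (by
      rintro (_ | x)
      · change u.var (b + 2) ≤ _; omega
      · change u.var (ρ x) ≤ _
        rw [hu _ (hρ x)]; exact (hv x).trans (by omega))
    have e : (fun x => u.var (ρ' (x + 1))) = fun x => s.var (ρ x) :=
      funext fun x => hu _ (hρ x)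
    have e' : u.var (ρ' 0) = j := hi
    simp only [e, e', harr] at this
    rw [harr]
    exact this
  let s₂ := ((s₁.setVar (b + 1) 0).setVar (b + 2) 0).setVar (b + 3) 1
  obtain ⟨s₃, n₃, hr₃, hn₃, harr₃, hI₁, hI₂, hI₃, hI₄, hI₅⟩ :=
    exists_runs_loop (x := b + 2) (y := b) (P := .seq Q (.seq (.add (b + 1) (b + 1) (b + 4))
      (.add (b + 2) (b + 2) (b + 3))))
    (fun i u => u.arr = s.arr ∧ (∀ y < b, u.var y = s.var y) ∧ u.var b = F ∧
      u.var (b + 1) = ∑ j ∈ range i, G j ∧ u.var (b + 2) = i ∧ u.var (b + 3) = 1) F (T + 2)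
    (by
      rintro i hi u ⟨harr, hu, h0, h1, h2, h3⟩
      obtain ⟨-, u', n, hr, hn, harr', h4, hu'⟩ := key i hi u harr hu h2
      refine ⟨by omega, _, _, .seq hr (.seq (.add _ _ _ _) (.add _ _ _ _)), by omega, ?_⟩
      refine ⟨harr'.trans harr, fun y hy => ?_, ?_, ?_, ?_, ?_⟩
      · have e1 : y ≠ b + 1 := by omega
        have e2 : y ≠ b + 2 := by omega
        simp [Store.setVar, e1, e2, hu' y (by omega), hu y hy]
      · simp [Store.setVar, hu', h0]
      · simp [Store.setVar, hu', h1, h4, sum_range_succ]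
      · simp [Store.setVar, hu', h2, h3]
      · simp [Store.setVar, hu', h3])
    (by rintro u ⟨-, -, h0, -, h2, -⟩; omega) s₂ (by
      refine ⟨harr₁, fun y hy => ?_, ?_, ?_, ?_, ?_⟩
      · have e1 : y ≠ b + 1 := by omega
        have e2 : y ≠ b + 2 := by omega
        have e3 : y ≠ b + 3 := by omega
        simp [s₂, Store.setVar, e1, e2, e3, hy₁ y hy]
      all_goals simp [s₂, Store.setVar, hb₁])
  have hsum : ∑ j ∈ range F, G j ≤ F * T := by
    simpa using sum_le_card_nsmul (range F) G T fun j hj => by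
      have hj' := mem_range.1 hj
      exact (key j hj' (s.setVar (b + 2) j) rfl (fun y hy => by
        simp [Store.setVar, show y ≠ b + 2 by omega]) (by simp [Store.setVar])).1
  have hFT : F * T ≤ p.eval X * T := Nat.mul_le_mul_right _ hfb
  have hFT' : F * (T + 2 + 1) ≤ p.eval X * (T + 3) := Nat.mul_le_mul_right _ hfb
  simp only [Polynomial.eval_add, Polynomial.eval_mul, Polynomial.eval_comp, Polynomial.eval_X,
    Polynomial.eval_ofNat]
  rw [← hT]
  refine ⟨by nlinarith, _, _, .seq hr₁ (.seq (.const _ _ _) (.seq (.const _ _ _)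
    (.seq (.const _ _ _) (.seq hr₃ (.seq (.const _ _ _) (.add _ _ _ _)))))), by omega, harr₃, ?_,
    fun y hy => ?_⟩
  · simp [Store.setVar, hI₃, hF, hG]
  · have e2 : y ≠ b + 2 := by omega
    simp [Store.setVar, e2, hy.ne, hI₁ y hy]

theorem mul (hf : Comp f) (hg : Comp g) : Comp fun a v => f a v * g a v := by
  simpa using hf.sum (g := fun a v _ => g a v) hg.weaken

theorem pow (hf : Comp f) (n : ℕ) : Comp fun a v => f a v ^ n := by
  induction n with
  | zero => simpa using const 1
  | succ n ih => simpa only [pow_succ] using ih.mul hf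

end Comp

open Classical in
/-- Polynomial-time decidable conditions on an array and finitely many variables. -/
def CompPred (P : (ℕ → ℕ) → (ℕ → ℕ) → Prop) : Prop :=
  Comp fun a v => if P a v then 1 else 0

namespace CompPred

variable {f g : (ℕ → ℕ) → (ℕ → ℕ) → ℕ} {P Q : (ℕ → ℕ) → (ℕ → ℕ) → Prop}

theorem congr (hP : CompPred P) (h : ∀ a v, P a v ↔ Q a v) : CompPred Q := by
  have : P = Q := funext fun a => funext fun v => propext (h a v)
  exact this ▸ hP

theorem not (hP : CompPred P) : CompPred fun a v => ¬ P a v := by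
  have := (Comp.const 1).sub hP
  unfold CompPred
  convert this using 3
  split_ifs <;> simp_all

theorem and (hP : CompPred P) (hQ : CompPred Q) : CompPred fun a v => P a v ∧ Q a v := by
  have := Comp.mul hP hQ
  unfold CompPred
  convert this using 3
  split_ifs <;> simp_all

theorem or (hP : CompPred P) (hQ : CompPred Q) : CompPred fun a v => P a v ∨ Q a v :=
  (hP.not.and hQ.not).not.congr fun _ _ => by tauto

theorem le (hf : Comp f) (hg : Comp g) : CompPred fun a v => f a v ≤ g a v := by
  have := (Comp.const 1).sub (hf.sub hg)
  unfold CompPred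
  convert this using 3
  split_ifs <;> omega

theorem lt (hf : Comp f) (hg : Comp g) : CompPred fun a v => f a v < g a v :=
  (le hg hf).not.congr fun _ _ => not_le

theorem eq (hf : Comp f) (hg : Comp g) : CompPred fun a v => f a v = g a v :=
  ((le hf hg).and (le hg hf)).congr fun _ _ => le_antisymm_iff.symm

theorem rename (hP : CompPred P) (σ : ℕ → ℕ) : CompPred fun a v => P a fun x => v (σ x) :=
  Comp.rename hP σ

open Classical in
theorem card_filter {R : (ℕ → ℕ) → (ℕ → ℕ) → ℕ → Prop} (hf : Comp f)
    (hR : CompPred fun a v => R a (fun x => v (x + 1)) (v 0)) :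
    Comp fun a v => #{j ∈ range (f a v) | R a v j} := by
  simpa only [Finset.card_filter] using
    hf.sum (g := fun a v j => if R a v j then 1 else 0) hR

theorem exists_lt {R : (ℕ → ℕ) → (ℕ → ℕ) → ℕ → Prop} (hf : Comp f)
    (hR : CompPred fun a v => R a (fun x => v (x + 1)) (v 0)) :
    CompPred fun a v => ∃ j < f a v, R a v j := by
  classical
  refine (lt (.const 0) (card_filter hf hR)).congr fun a v => ?_
  simp [Finset.card_pos, Finset.Nonempty]

end CompPred

theorem Comp.div {f g : (ℕ → ℕ) → (ℕ → ℕ) → ℕ} (hf : Comp f) (hg : Comp g)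
    (hpos : ∀ a v, 0 < g a v) : Comp fun a v => f a v / g a v := by
  classical
  have := CompPred.card_filter (R := fun a v j => (j + 1) * g a v ≤ f a v) hf
    (.le (((Comp.var 0).add (.const 1)).mul hg.weaken) hf.weaken)
  convert this using 3 with a v
  rw [← Finset.card_range (f a v / g a v)]
  congr 1
  ext j
  simp only [mem_range, mem_filter, ← Nat.le_div_iff_mul_le (hpos a v), Nat.succ_le_iff]
  exact ⟨fun h => ⟨h.trans_le (Nat.div_le_self _ _), h⟩, fun h => h.2⟩

open Classical in
/-- Bounded search for the greatest solution of a condition. -/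
theorem CompPred.findGreatest {f : (ℕ → ℕ) → (ℕ → ℕ) → ℕ} {R : (ℕ → ℕ) → (ℕ → ℕ) → ℕ → Prop}
    (hf : Comp f) (hR : CompPred fun a v => R a (fun x => v (x + 1)) (v 0)) :
    Comp fun a v => Nat.findGreatest (R a v) (f a v) := by
  have := CompPred.card_filter (R := fun a v j => ∃ w < f a v + 1, R a v w ∧ j < w) hf
    (CompPred.exists_lt (R := fun a v w => R a (fun x => v (x + 1)) w ∧ v 0 < w)
      (hf.weaken.add (.const 1))
      (.and (hR.rename fun x => Nat.casesOn x 0 fun y => y + 2) (.lt (.var 1) (.var 0))))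
  convert this using 3 with a v
  rw [← Finset.card_range (Nat.findGreatest _ _)]
  congr 1
  ext j
  simp only [mem_range, mem_filter]
  constructor
  · intro h
    have hle := Nat.findGreatest_le (P := R a v) (f a v)
    exact ⟨h.trans_le hle, _, Nat.lt_succ_of_le hle,
      Nat.findGreatest_of_ne_zero rfl (Nat.ne_zero_of_lt h), h⟩
  · rintro ⟨-, w, hw, hR, hj⟩
    exact hj.trans_le (Nat.le_findGreatest (Nat.le_of_lt_succ hw) hR)

end RAM

/-! ### Sparse sequences of blocks -/

namespace Greedy

open Finset

/-- The `i`-th of the consecutive blocks of length `k` of a sequence, as a set. -/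
def block (a : ℕ → ℕ) (k i : ℕ) : Finset ℕ :=
  (range k).image fun j => a (i * k + j)

/-- The elements `v` and `w` are joined by a walk of length at most `j` in the hypergraph formed by
the blocks of `a` among the positions below `N`: each step goes from an element of a block to an
element of the same block. -/
def Near (a : ℕ → ℕ) (k N : ℕ) : ℕ → ℕ → ℕ → Prop
  | 0, v, w => v = w
  | j + 1, v, w => Near a k N j v w ∨
      ∃ p < N, ∃ p' < N, p / k = p' / k ∧ Near a k N j v (a p) ∧ a p' = w

/-- The number of occurrences of `v` among the first `n` members of the sequence `a`. -/
def occ (a : ℕ → ℕ) (n v : ℕ) : ℕ :=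
  #{p ∈ range n | a p = v}

/-- The condition under which the greedy algorithm may write `v` at position `n`: the element `v` is
not yet saturated, and it is far, with respect to the completed blocks, from the elements that
stand already in the block under construction. The bound `2 * m * k / q` on the number of
occurrences is twice the average over `{1, …, q}` of all `m` blocks of length `k`. -/
structure Admissible (t q k m : ℕ) (a : ℕ → ℕ) (n v : ℕ) : Prop where
  pos : 1 ≤ v
  le : v ≤ q
  occ_lt : occ a n v * q < 2 * m * k
  far : ∀ p < n, n / k * k ≤ p → ¬ Near a k (n / k * k) (t - 1) v (a p)

variable {a a' : ℕ → ℕ} {k N : ℕ}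

theorem near_congr (h : ∀ p < N, a p = a' p) (j v w : ℕ) :
    Near a k N j v w ↔ Near a' k N j v w := by
  induction j generalizing w with
  | zero => rfl
  | succ j ih =>
    simp only [Near, ih]
    refine or_congr Iff.rfl (exists_congr fun p => and_congr_right fun hp =>
      exists_congr fun p' => and_congr_right fun hp' => ?_)
    rw [h p hp, h p' hp']

theorem Near.mono {i j v w : ℕ} (hij : i ≤ j) (h : Near a k N i v w) : Near a k N j v w := by
  induction hij with
  | refl => exact h
  | step _ ih => exact .inl ih

theorem Near.refl (j v : ℕ) : Near a k N j v v :=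
  Near.mono (i := 0) (Nat.zero_le j) rfl

theorem mul_add_lt {e i j : ℕ} (hi : i < e) (hj : j < k) : i * k + j < e * k :=
  calc i * k + j < (i + 1) * k := by rw [Nat.succ_mul]; omega
    _ ≤ e * k := Nat.mul_le_mul_right k hi

theorem mul_add_div {i j : ℕ} (hj : j < k) : (i * k + j) / k = i := by
  rw [Nat.add_comm, Nat.add_mul_div_right _ _ (by omega), Nat.div_eq_of_lt hj, Nat.zero_add]

theorem Near.step {e i j v u w : ℕ} (hi : i < e) (hu : u ∈ block a k i) (hw : w ∈ block a k i)
    (h : Near a k (e * k) j v u) : Near a k (e * k) (j + 1) v w := by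
  simp only [block, mem_image, mem_range] at hu hw
  obtain ⟨x, hx, rfl⟩ := hu
  obtain ⟨y, hy, rfl⟩ := hw
  exact .inr ⟨_, mul_add_lt hi hx, _, mul_add_lt hi hy, by rw [mul_add_div hx, mul_add_div hy],
    h, rfl⟩

/-- The blocks of `S` that belong to the connected component of `x`: together with `x` they form a
set that the other blocks of `S` avoid and whose elements are reached from `x` in at most as many
steps as there are blocks. -/
theorem exists_component {e : ℕ} (S : Finset ℕ) (hS : ∀ i ∈ S, i < e) (x : ℕ) :
    ∃ T ⊆ S, (∀ y ∈ insert x (T.biUnion (block a k)), Near a k (e * k) #T x y) ∧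
      ∀ i ∈ S \ T, Disjoint (block a k i) (insert x (T.biUnion (block a k))) := by
  classical
  -- A largest `T` satisfying the first condition satisfies the second one.
  obtain ⟨T, hT, hmax⟩ := exists_max_image
    {T ∈ S.powerset | ∀ y ∈ insert x (T.biUnion (block a k)), Near a k (e * k) #T x y} card
    ⟨∅, by simp [Near]⟩
  simp only [mem_filter, mem_powerset] at hT hmax
  refine ⟨T, hT.1, hT.2, fun i hi => ?_⟩
  obtain ⟨hiS, hiT⟩ := mem_sdiff.1 hi
  by_contra hmeet
  obtain ⟨u, hu, hu'⟩ := not_disjoint_iff.1 hmeet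
  have := hmax (insert i T) ⟨insert_subset hiS hT.1, fun y hy => ?_⟩
  · rw [card_insert_of_notMem hiT] at this
    omega
  · rw [card_insert_of_notMem hiT]
    by_cases hy' : y ∈ insert x (T.biUnion (block a k))
    · exact .inl (hT.2 y hy')
    · have hyi : y ∈ block a k i := by
        simp only [biUnion_insert, mem_insert, mem_union] at hy hy'
        tauto
      exact (hT.2 u hu').step (hS i hiS) hu hyi

/-- If the elements of every block are pairwise far with respect to the preceding blocks, then few
blocks have a large union. The last block `e` of a set of blocks meets every connected component of
the others at most once; the components that it meets are split off one at a time. -/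
theorem le_card_biUnion_block {r m t : ℕ}
    (hfar : ∀ n < m * (r + 1), ∀ p < n, n / (r + 1) * (r + 1) ≤ p →
      ¬ Near a (r + 1) (n / (r + 1) * (r + 1)) (t - 1) (a n) (a p))
    (S : Finset ℕ) (hSm : ∀ i ∈ S, i < m) (hne : S.Nonempty) (hSt : #S ≤ t) :
    #S * r + 1 ≤ #(S.biUnion (block a (r + 1))) := by
  induction S using Finset.strongInduction with
  | H S ih =>
  set e := S.max' hne with he
  have heS : e ∈ S := S.max'_mem hne
  have hlt : ∀ i ∈ S.erase e, i < e := fun i hi => S.lt_max'_of_mem_erase_max' hne hi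
  have hcard : #(S.erase e) + 1 = #S := card_erase_add_one heS
  have hsub : ∀ S' ⊆ S.erase e, S'.Nonempty →
      #S' * r + 1 ≤ #(S'.biUnion (block a (r + 1))) := fun S' hS' hne' =>
    ih S' (hS'.trans_ssubset (erase_ssubset heS))
      (fun i hi => hSm i (mem_of_mem_erase (hS' hi))) hne'
      ((card_le_card hS').trans (by omega))
  have claim : ∀ P : Finset ℕ, (∀ p ∈ P, e * (r + 1) ≤ p ∧ p < e * (r + 1) + (r + 1)) →
      ∀ S' ⊆ S.erase e,
        #S' * r + #P ≤ #(P.image a ∪ S'.biUnion (block a (r + 1))) := by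
    intro P
    induction P using Finset.induction_on_max with
    | empty =>
      intro _ S' hS'
      rcases S'.eq_empty_or_nonempty with rfl | hne'
      · simp
      · have := hsub S' hS' hne'
        simp only [card_empty, image_empty, empty_union]
        omega
    | insert n P hmax ihP =>
      intro hP S' hS'
      obtain ⟨T, hTS, hnear, hdisj⟩ :=
        exists_component (a := a) (k := r + 1) S' (fun i hi => hlt i (hS' hi)) (a n)
      have hn := hP n (mem_insert_self n P)
      have hnP : n ∉ P := fun h => (hmax n h).false
      have hdiv : n / (r + 1) = e := by
        have := mul_add_div (k := r + 1) (i := e) (j := n - e * (r + 1)) (by omega)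
        rwa [Nat.add_sub_cancel' hn.1] at this
      have hT : #T * r + 1 ≤ #(insert (a n) (T.biUnion (block a (r + 1)))) := by
        rcases T.eq_empty_or_nonempty with rfl | hne'
        · simp
        · exact (hsub T (hTS.trans hS') hne').trans (card_le_card (subset_insert _ _))
      have hrest := ihP (fun p hp => hP p (mem_insert_of_mem hp)) (S' \ T)
        (sdiff_subset.trans hS')
      have hTc : #T ≤ t - 1 := by
        have := card_le_card (hTS.trans hS')
        omega
      have hd : Disjoint (insert (a n) (T.biUnion (block a (r + 1))))
          (P.image a ∪ (S' \ T).biUnion (block a (r + 1))) := by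
        rw [disjoint_union_right, disjoint_biUnion_right]
        refine ⟨disjoint_left.2 fun y hy hyP => ?_, fun i hi => (hdisj i hi).symm⟩
        obtain ⟨p, hp, rfl⟩ := mem_image.1 hyP
        refine hfar n ?_ p (hmax p hp) ?_ ?_
        · have := Nat.mul_le_mul_right (r + 1) (hSm e heS)
          rw [Nat.succ_mul] at this
          omega
        · rw [hdiv]; exact (hP p (mem_insert_of_mem hp)).1
        · rw [hdiv]; exact (hnear _ hy).mono hTc
      have hle := card_le_card (s := insert (a n) (T.biUnion (block a (r + 1))) ∪
          (P.image a ∪ (S' \ T).biUnion (block a (r + 1))))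
        (t := (insert n P).image a ∪ S'.biUnion (block a (r + 1))) (by
          have h1 := biUnion_subset_biUnion_of_subset_left (block a (r + 1)) hTS
          have h2 := biUnion_subset_biUnion_of_subset_left (block a (r + 1))
            (sdiff_subset (s := S') (t := T))
          rw [image_insert]
          intro y hy
          simp only [mem_union, mem_insert] at hy ⊢
          rcases hy with (h | h) | h | h
          · exact .inl (.inl h)
          · exact .inr (h1 h)
          · exact .inl (.inr h)
          · exact .inr (h2 h))
      rw [card_union_of_disjoint hd] at hle
      have hsplit : #(S' \ T) * r + #T * r = #S' * r := by
        rw [← Nat.add_mul, card_sdiff_add_card_eq_card hTS]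
      rw [card_insert_of_notMem hnP]
      omega
  have hmain := claim (Ico (e * (r + 1)) (e * (r + 1) + (r + 1)))
    (fun p hp => mem_Ico.1 hp) (S.erase e) Subset.rfl
  have himg : (Ico (e * (r + 1)) (e * (r + 1) + (r + 1))).image a = block a (r + 1) e := by
    ext y
    simp only [block, mem_image, mem_Ico, mem_range]
    constructor
    · rintro ⟨p, hp, rfl⟩
      exact ⟨p - e * (r + 1), by omega, by congr 1; omega⟩
    · rintro ⟨j, hj, rfl⟩
      exact ⟨_, ⟨by omega, by omega⟩, rfl⟩
  rw [himg, ← biUnion_insert, insert_erase heS, Nat.card_Ico] at hmain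
  have : #S * r = #(S.erase e) * r + r := by rw [← hcard, Nat.succ_mul]
  omega

/-! ### The greedy algorithm never gets stuck -/

open Classical in
/-- Balls of radius `j` have at most `L ^ j` elements when every element has at most `L / k`
occurrences. -/
theorem card_near_le {L : ℕ} (hL : 1 ≤ L) (hocc : ∀ w, occ a N w * k ≤ L) (hk : 0 < k)
    (F : Finset ℕ) (j w : ℕ) : #{v ∈ F | Near a k N j v w} ≤ L ^ j := by
  induction j generalizing w with
  | zero =>
    refine (card_le_card (t := {w}) fun v hv => ?_).trans (by simp)
    exact mem_singleton.2 (mem_filter.1 hv).2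
  | succ j ih =>
    by_cases hw : ∃ p < N, a p = w
    · obtain ⟨p₀, hp₀, hw₀⟩ := hw
      calc #{v ∈ F | Near a k N (j + 1) v w}
          ≤ #({p ∈ range N | a p = w}.biUnion fun p => (range k).biUnion fun i =>
              {v ∈ F | Near a k N j v (a (p / k * k + i))}) := card_le_card ?_
        _ ≤ #{p ∈ range N | a p = w} * (k * L ^ j) :=
            card_biUnion_le_card_mul _ _ _ fun p _ => by
              simpa using card_biUnion_le_card_mul (range k) _ _ fun i _ =>
                ih (a (p / k * k + i))
        _ ≤ L ^ (j + 1) := by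
            rw [← mul_assoc, pow_succ']
            exact Nat.mul_le_mul_right _ (hocc w)
      intro v hv
      simp only [mem_filter, mem_biUnion, mem_range] at hv ⊢
      -- The walk ends with a step inside a block containing `w`; this step may be trivial.
      obtain ⟨p, p', hp', hpp', hnear, hw'⟩ : ∃ p, ∃ p' < N, p / k = p' / k ∧
          Near a k N j v (a p) ∧ a p' = w := by
        rcases hv.2 with h | ⟨p, -, p', h⟩
        · exact ⟨p₀, p₀, hp₀, rfl, hw₀ ▸ h, hw₀⟩
        · exact ⟨p, p', h⟩
      refine ⟨p', ⟨hp', hw'⟩, p % k, Nat.mod_lt _ hk, hv.1, ?_⟩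
      rwa [← hpp', Nat.div_add_mod']
    · refine (card_le_card fun v hv => ?_).trans ((ih w).trans (Nat.pow_le_pow_right hL
        (Nat.le_succ j)))
      simp only [mem_filter] at hv ⊢
      refine ⟨hv.1, hv.2.resolve_right ?_⟩
      rintro ⟨-, -, p', hp', -, -, h⟩
      exact hw ⟨p', hp', h⟩

theorem eq_of_near_of_occ_eq_zero {v : ℕ} (h : occ a N v = 0) {j w : ℕ}
    (hw : Near a k N j v w) : v = w := by
  induction j generalizing w with
  | zero => exact hw
  | succ j ih =>
    rcases hw with hw | ⟨p, hp, -, -, -, hn, -⟩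
    · exact ih hw
    · rw [occ, card_eq_zero] at h
      have : p ∈ ({p ∈ range N | a p = v} : Finset ℕ) := by simp [hp, ih hn]
      simp [h] at this

theorem occ_mono {n : ℕ} (h : N ≤ n) (v : ℕ) : occ a N v ≤ occ a n v :=
  card_le_card (filter_subset_filter _ (range_subset_range.2 h))

theorem occ_succ (a : ℕ → ℕ) (n v : ℕ) :
    occ a (n + 1) v = occ a n v + if a n = v then 1 else 0 := by
  rw [occ, range_add_one, filter_insert]
  split_ifs
  · rw [card_insert_of_notMem (by simp), occ]
  · rfl

theorem sub_one_mul_occ_lt {n q B : ℕ} (hB : 0 < B) (h : ∀ p < n, occ a p (a p) * q < B) (v : ℕ) :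
    (occ a n v - 1) * q < B := by
  induction n with
  | zero => simpa [occ] using hB
  | succ n ih =>
    rw [occ_succ]
    split_ifs with hv
    · subst hv
      simpa using h n (Nat.lt_succ_self n)
    · exact ih fun p hp => h p (hp.trans (Nat.lt_succ_self n))

/-- Fewer than half of the elements are saturated, because the average number of occurrences is at
most half of the bound. -/
theorem lt_two_mul_card_unsaturated {n q B : ℕ} (hq : 0 < q) (hB : 2 * n < B) :
    q < 2 * #{v ∈ Icc 1 q | occ a n v * q < B} := by
  have hsplit := card_filter_add_card_filter_not (s := Icc 1 q) fun v => occ a n v * q < B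
  rw [Nat.card_Icc, Nat.add_sub_cancel] at hsplit
  set W := {v ∈ Icc 1 q | ¬ occ a n v * q < B} with hW
  have hsum : ∑ v ∈ W, occ a n v ≤ n := by
    have := (sum_card_fiberwise_eq_card_filter (range n) W a).trans_le (card_filter_le _ _)
    simpa [occ] using this
  have : #W * B ≤ n * q := calc
    #W * B = ∑ v ∈ W, B := by simp
    _ ≤ ∑ v ∈ W, occ a n v * q := sum_le_sum fun v hv => not_lt.1 (mem_filter.1 hv).2
    _ = (∑ v ∈ W, occ a n v) * q := (sum_mul _ _ _).symm
    _ ≤ n * q := Nat.mul_le_mul_right q hsum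
  have : 2 * #W < q := by
    by_contra! h
    have h1 : q * B ≤ 2 * #W * B := Nat.mul_le_mul_right B h
    have h2 : q * (2 * n) < q * B := Nat.mul_lt_mul_of_pos_left hB hq
    nlinarith
  omega

/-- The comparison of the size of a ball with the number of elements, where `D` is a bound on the
number of occurrences of an element in the hypergraph of `m` blocks. -/
theorem two_mul_ball_lt {t k q m D : ℕ} (ht : 3 ≤ t) (hk : 0 < k) (hq : 2 * k ≤ q)
    (hm : (m - 1) ^ (t - 1) * ((2 * t ^ 2) ^ (t - 1) * k ^ (2 * t)) < q ^ t)
    (hqm : q < 2 * m * k) (hD : D * q ≤ 4 * m * k) :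
    2 * k * (D * k) ^ (t - 1) < q := by
  obtain ⟨s, rfl⟩ : ∃ s, t = s + 1 := ⟨t - 1, by omega⟩
  rw [Nat.add_sub_cancel] at *
  have hm2 : m ≤ 2 * (m - 1) := by
    by_contra! h
    have : m ≤ 1 := by omega
    have : 2 * m * k ≤ 2 * 1 * k := by gcongr
    omega
  have hq0 : 0 < q := by omega
  have h9 : 2 * 4 ^ s ≤ ((s + 1) ^ 2) ^ s := calc
    2 * 4 ^ s ≤ 2 ^ s * 4 ^ s := by
      gcongr
      exact Nat.le_self_pow (by omega) 2
    _ = 8 ^ s := by rw [← mul_pow]; norm_num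
    _ ≤ ((s + 1) ^ 2) ^ s := by gcongr; nlinarith
  have hDk : D * q * k ≤ 4 * (2 * (m - 1)) * k * k :=
    Nat.mul_le_mul_right k (hD.trans (by gcongr))
  have key : (2 * k * (D * k) ^ s) * (4 ^ s * q ^ s) < q * (4 ^ s * q ^ s) := calc
    (2 * k * (D * k) ^ s) * (4 ^ s * q ^ s) = (2 * 4 ^ s) * k * (D * q * k) ^ s := by
      simp only [mul_pow]; ring
    _ ≤ ((s + 1) ^ 2) ^ s * k ^ 2 * (4 * (2 * (m - 1)) * k * k) ^ s :=
      Nat.mul_le_mul (Nat.mul_le_mul h9 (Nat.le_self_pow (by omega) k))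
        (Nat.pow_le_pow_left hDk s)
    _ = 4 ^ s * ((m - 1) ^ s * ((2 * (s + 1) ^ 2) ^ s * k ^ (2 * (s + 1)))) := by
      rw [show 4 * (2 * (m - 1)) * k * k = 4 * (m - 1) * 2 * k ^ 2 by ring]
      simp only [mul_pow]; ring
    _ < 4 ^ s * q ^ (s + 1) := by gcongr
    _ = q * (4 ^ s * q ^ s) := by ring
  exact lt_of_mul_lt_mul_right key (Nat.zero_le _)

/-- While fewer than `m` blocks are complete, the construction can be continued. The hypothesis `hm`
says that `m - 1` is less than the quotient that is rounded up to the number of sets. -/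
theorem exists_admissible {t r q m n : ℕ} (ht : 3 ≤ t) (hq : 2 * (r + 1) ≤ q)
    (hm : (m - 1) ^ (t - 1) * ((2 * t ^ 2) ^ (t - 1) * (r + 1) ^ (2 * t)) < q ^ t)
    (hn : n < m * (r + 1)) (h : ∀ p < n, Admissible t q (r + 1) m a p (a p)) :
    ∃ v, Admissible t q (r + 1) m a n v := by
  classical
  set k := r + 1 with hk
  set N := n / k * k with hN
  have hNn : N ≤ n := Nat.div_mul_le_self n k
  have hnN : n < N + k := Nat.lt_div_mul_add (by omega)
  have hB : 0 < 2 * m * k := by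
    have : 2 * m * k = 2 * (m * k) := by ring
    omega
  set U := {v ∈ Icc 1 q | occ a n v * q < 2 * m * k} with hU
  have hUcard : q < 2 * #U := lt_two_mul_card_unsaturated (by omega) (by linarith)
  have hocc : ∀ v, (occ a N v - 1) * q < 2 * m * k := fun v =>
    (Nat.mul_le_mul_right q (Nat.sub_le_sub_right (occ_mono hNn v) 1)).trans_lt
      (sub_one_mul_occ_lt hB (fun p hp => (h p hp).occ_lt) v)
  obtain ⟨R, hR, hball⟩ : ∃ R, 2 * k * R ≤ q ∧
      ∀ p ∈ Ico N n, #{v ∈ U | Near a k N (t - 1) v (a p)} ≤ R := by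
    rcases le_or_gt (2 * m * k) q with hle | hlt
    · -- Here the elements of `U` do not occur at all, so that they are far from everything else.
      refine ⟨1, by omega, fun p hp => (card_le_card (t := {a p}) fun v hv => ?_).trans (by simp)⟩
      obtain ⟨hvU, hnear⟩ := mem_filter.1 hv
      have h0 : occ a n v = 0 := by
        by_contra hne
        have := (mem_filter.1 hvU).2
        have := Nat.le_mul_of_pos_left q (Nat.pos_of_ne_zero hne)
        omega
      exact mem_singleton.2
        (eq_of_near_of_occ_eq_zero (Nat.le_zero.1 (h0 ▸ occ_mono hNn v)) hnear)
    · set D := 2 * m * k / q + 1 with hD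
      have hDq : D * q ≤ 4 * m * k := by
        have := Nat.div_mul_le_self (2 * m * k) q
        rw [hD, Nat.succ_mul]
        linarith
      refine ⟨(D * k) ^ (t - 1), (two_mul_ball_lt ht (by omega) hq hm hlt hDq).le,
        fun p _ => card_near_le (Nat.mul_pos (Nat.succ_pos _) (Nat.succ_pos r)) (fun w => ?_) (by omega) U
          (t - 1) (a p)⟩
      have : occ a N w - 1 ≤ 2 * m * k / q :=
        (Nat.le_div_iff_mul_le (by omega)).2 (hocc w).le
      gcongr
      omega
  obtain ⟨v, hv, hfar⟩ : ∃ v ∈ U, ∀ p ∈ Ico N n, ¬ Near a k N (t - 1) v (a p) := by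
    by_contra! hbad
    have hsub : U ⊆ (Ico N n).biUnion fun p => {v ∈ U | Near a k N (t - 1) v (a p)} := by
      intro v hv
      obtain ⟨p, hp, hnear⟩ := hbad v hv
      exact mem_biUnion.2 ⟨p, hp, mem_filter.2 ⟨hv, hnear⟩⟩
    have h1 := (card_le_card hsub).trans (card_biUnion_le_card_mul _ _ R hball)
    rw [Nat.card_Ico] at h1
    have h2 : (n - N) * R ≤ k * R := Nat.mul_le_mul_right R (by omega)
    linarith
  obtain ⟨hvq, hvocc⟩ := mem_filter.1 hv
  exact ⟨v, (mem_Icc.1 hvq).1, (mem_Icc.1 hvq).2, hvocc,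
    fun p hp hNp => hfar p (mem_Ico.2 ⟨hNp, hp⟩)⟩

theorem admissible_congr {t q m n v : ℕ} (h : ∀ p < n, a p = a' p) :
    Admissible t q k m a n v ↔ Admissible t q k m a' n v := by
  have hN : n / k * k ≤ n := Nat.div_mul_le_self n k
  have hocc : occ a n v = occ a' n v := by
    rw [occ, occ, filter_congr fun p hp => by rw [h p (mem_range.1 hp)]]
  have hfar : (∀ p < n, n / k * k ≤ p → ¬ Near a k (n / k * k) (t - 1) v (a p)) ↔
      ∀ p < n, n / k * k ≤ p → ¬ Near a' k (n / k * k) (t - 1) v (a' p) := by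
    refine forall_congr' fun p => forall_congr' fun hp => ?_
    rw [near_congr (fun i hi => h i (hi.trans_le hN)), h p hp]
  exact ⟨fun ⟨h1, h2, h3, h4⟩ => ⟨h1, h2, hocc ▸ h3, hfar.1 h4⟩,
    fun ⟨h1, h2, h3, h4⟩ => ⟨h1, h2, hocc ▸ h3, hfar.2 h4⟩⟩

/-- The blocks of a sequence of admissible elements form a good family. -/
theorem isGoodFamily_block {t r q m : ℕ}
    (h : ∀ n < m * (r + 1), Admissible t q (r + 1) m a n (a n)) :
    IsGoodFamily t r q m fun i => block a (r + 1) i := by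
  have hpos : ∀ i : Fin m, ∀ j < r + 1, (i : ℕ) * (r + 1) + j < m * (r + 1) :=
    fun i j hj => mul_add_lt i.2 hj
  refine ⟨fun i x hx => ?_, fun i => ?_, fun S hne hSt => ?_⟩
  · obtain ⟨j, hj, rfl⟩ := mem_image.1 hx
    have := h _ (hpos i j (mem_range.1 hj))
    exact mem_Icc.2 ⟨this.pos, this.le⟩
  · have hinj : ∀ j < r + 1, ∀ j' < j, a (i * (r + 1) + j) ≠ a (i * (r + 1) + j') := by
      intro j hj j' hj' heq
      refine (h _ (hpos i j hj)).far (i * (r + 1) + j') (by omega) ?_ (heq ▸ Near.refl _ _)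
      rw [mul_add_div hj]
      omega
    rw [block, card_image_of_injOn, card_range]
    intro j hj j' hj' heq
    simp only [coe_range, Set.mem_Iio] at hj hj'
    rcases lt_trichotomy j j' with hlt | rfl | hlt
    · exact (hinj j' hj' j hlt heq.symm).elim
    · rfl
    · exact (hinj j hj j' hlt heq).elim
  · have := le_card_biUnion_block (fun n hn => (h n hn).far) (S.map Fin.valEmbedding)
      (by simp) (by simpa using hne) (by simpa using hSt)
    simpa [map_eq_image, image_biUnion, card_image_of_injective _ Fin.val_injective]
      using this

end Greedy

/-! ### The greedy algorithm as a program -/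

namespace Greedy

open Finset RAM

theorem compPred_near {K M V W : (ℕ → ℕ) → (ℕ → ℕ) → ℕ} (hK : Comp K) (hK0 : ∀ a v, 0 < K a v)
    (hM : Comp M) (hV : Comp V) (hW : Comp W) (j : ℕ) :
    CompPred fun a v => Near a (K a v) (M a v) j (V a v) (W a v) := by
  induction j generalizing K M V W with
  | zero => exact .eq hV hW
  | succ j ih =>
    refine (ih hK hK0 hM hV hW).or (.exists_lt hM (.exists_lt hM.weaken ?_))
    exact .and (.eq (Comp.div (.var 1) hK.weaken.weaken fun _ _ => hK0 _ _)
        (Comp.div (.var 0) hK.weaken.weaken fun _ _ => hK0 _ _))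
      (.and (ih hK.weaken.weaken (fun _ _ => hK0 _ _) hM.weaken.weaken hV.weaken.weaken
        (Comp.var 1).read) (.eq (Comp.var 0).read hW.weaken.weaken))

theorem comp_occ {N V : (ℕ → ℕ) → (ℕ → ℕ) → ℕ} (hN : Comp N) (hV : Comp V) :
    Comp fun a v => occ a (N a v) (V a v) := by
  have := CompPred.card_filter (R := fun a v p => a p = V a v) hN
    (.eq (Comp.var 0).read hV.weaken)
  unfold occ
  convert this

theorem compPred_admissible (t : ℕ) {Q R M N V : (ℕ → ℕ) → (ℕ → ℕ) → ℕ} (hQ : Comp Q)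
    (hR : Comp R) (hM : Comp M) (hN : Comp N) (hV : Comp V) :
    CompPred fun a v => Admissible t (Q a v) (R a v + 1) (M a v) a (N a v) (V a v) := by
  have hK := hR.add (.const 1)
  have hS := (hN.div hK fun _ _ => Nat.succ_pos _).mul hK
  have hfar := CompPred.exists_lt
    (R := fun a v p => N a v / (R a v + 1) * (R a v + 1) ≤ p ∧
      Near a (R a v + 1) (N a v / (R a v + 1) * (R a v + 1)) (t - 1) (V a v) (a p)) hN
    (.and (.le hS.weaken (.var 0)) (compPred_near hK.weaken (fun _ _ => Nat.succ_pos _) hS.weaken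
      hV.weaken (Comp.var 0).read (t - 1)))
  refine ((CompPred.le (.const 1) hV).and ((CompPred.le hV hQ).and
    ((CompPred.lt ((comp_occ hN hV).mul hQ) (((Comp.const 2).mul hM).mul hK)).and
      hfar.not))).congr fun a v => ?_
  constructor
  · rintro ⟨h1, h2, h3, h4⟩
    exact ⟨h1, h2, h3, fun p hp hp' hnear => h4 ⟨p, hp, hp', hnear⟩⟩
  · rintro ⟨h1, h2, h3, h4⟩
    exact ⟨h1, h2, h3, fun ⟨p, hp, hp', hnear⟩ => h4 p hp hp' hnear⟩

/-- The number of sets, as the number of naturals smaller than the quotient in the definition of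
`numSets`; after raising to the power `t - 1` the comparison is one between integers. -/
def count (t q r : ℕ) : ℕ :=
  #{c ∈ range (q ^ 2) | c ^ (t - 1) * ((2 * t ^ 2) ^ (t - 1) * (r + 1) ^ (2 * t)) < q ^ t}

open Classical in
/-- The element that the greedy algorithm writes at position `n`: the greatest admissible one. -/
noncomputable def choice (t : ℕ) (a : ℕ → ℕ) (q r m n : ℕ) : ℕ :=
  Nat.findGreatest (Admissible t q (r + 1) m a n) q

/-- The array after `n` rounds of writing `c a i` at position `i` of the current array `a`. -/
def build (c : (ℕ → ℕ) → ℕ → ℕ) : ℕ → ℕ → ℕ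
  | 0 => fun _ => 0
  | n + 1 => Function.update (build c n) n (c (build c n) n)

theorem build_eq {c : (ℕ → ℕ) → ℕ → ℕ} {p n : ℕ} (h : p < n) :
    build c n p = c (build c p) p := by
  induction h with
  | refl => simp [build]
  | step hpn ih => rw [build, Function.update_of_ne (Nat.ne_of_lt hpn), ih]

theorem comp_count (t : ℕ) : Comp fun _ v => count t (v 0) (v 1) := by
  have := CompPred.card_filter (R := fun _ v c =>
      c ^ (t - 1) * ((2 * t ^ 2) ^ (t - 1) * (v 1 + 1) ^ (2 * t)) < v 0 ^ t)
    ((Comp.var 0).pow 2)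
    (.lt (((Comp.var 0).pow _).mul ((Comp.const _).mul (((Comp.var 2).add (.const 1)).pow _)))
      ((Comp.var 1).pow t))
  unfold count
  convert this

theorem comp_choice (t : ℕ) : Comp fun a v => choice t a (v 0) (v 1) (v 2) (v 3) :=
  CompPred.findGreatest (R := fun a v w => Admissible t (v 0) (v 1 + 1) (v 2) a (v 3) w) (.var 0)
    (compPred_admissible t (.var 1) (.var 2) (.var 3) (.var 4) (.var 0))

theorem monotone_eval_nat (p : Polynomial ℕ) : Monotone fun x => p.eval x := by
  intro x y h
  simp only [Polynomial.eval_eq_sum, Polynomial.sum]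
  gcongr

/-- A program that computes the number `m = f q r` and then fills the first `m * (r + 1)` cells of
array `0` one after the other, each according to the contents of the preceding ones. -/
theorem exists_prog_build {f : ℕ → ℕ → ℕ} {c : (ℕ → ℕ) → ℕ → ℕ → ℕ → ℕ → ℕ}
    (hf : Comp fun _ v => f (v 0) (v 1)) (hc : Comp fun a v => c a (v 0) (v 1) (v 2) (v 3))
    (hcq : ∀ a q r m n, c a q r m n ≤ q) :
    ∃ (P : Prog) (p : Polynomial ℕ), ∀ q r, ∃ s n, Runs P (input q r) s n ∧ n ≤ p.eval (q + r) ∧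
      s.var 0 = f q r ∧
      s.arr 0 = build (fun a n => c a q r (f q r) n) (f q r * (r + 1)) := by
  -- The variables are: `2` the number `m`, `3` the position, `4` the number of positions,
  -- `5` the literal `1`, and `6` the element to be written.
  obtain ⟨P₁, p₁, hP₁⟩ := hf (fun x => if x < 2 then x else 0) 2 (by intro x; split_ifs <;> omega)
  obtain ⟨P₂, p₂, hP₂⟩ := ((Comp.var 2).mul ((Comp.var 1).add (.const 1)))
    (fun x => if x < 3 then x else 0) 4 (by intro x; split_ifs <;> omega)
  obtain ⟨P₃, p₃, hP₃⟩ := hc (fun x => if x < 4 then x else 0) 6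
    (by intro x; split_ifs <;> omega)
  refine ⟨.seq P₁ (.seq P₂ (.seq (.const 3 0) (.seq (.const 5 1)
    (.seq (.loop 3 4 (.seq P₃ (.seq (.store 0 3 6) (.add 3 3 5))))
      (.seq (.const 3 0) (.add 0 2 3)))))),
    p₁ + p₂.comp (Polynomial.X + p₁) + (p₁ * (Polynomial.X + 1)) *
      (p₃.comp (Polynomial.X + p₁ + p₁ * (Polynomial.X + 1)) + 3) + 5, fun q r => ?_⟩
  set m := f q r with hm
  set X := q + r with hX
  obtain ⟨hle₁, s₁, n₁, hr₁, hn₁, harr₁, h2₁, hy₁⟩ := hP₁ (input q r) X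
    (fun i => by simp [input]) (fun x => by simp only [input]; grind)
  have h0 : s₁.var 0 = q := by rw [hy₁ 0 (by omega)]; rfl
  have h1 : s₁.var 1 = r := by rw [hy₁ 1 (by omega)]; rfl
  replace hle₁ : m ≤ p₁.eval X := hle₁
  replace h2₁ : s₁.var 2 = m := h2₁
  obtain ⟨-, s₂, n₂, hr₂, hn₂, harr₂, h4₂, hy₂⟩ := hP₂ s₁ (X + p₁.eval X)
    (fun i => by simp [harr₁, input]) (fun x => by
      have : ∀ y < 3, s₁.var y ≤ X + p₁.eval X := by
        intro y hy
        interval_cases y <;> omega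
      exact this _ (by split_ifs <;> omega))
  replace h4₂ : s₂.var 4 = m * (r + 1) := by simpa [h1, h2₁] using h4₂
  set B := m * (r + 1) with hB
  have hBle : B ≤ p₁.eval X * (X + 1) := Nat.mul_le_mul hle₁ (by omega)
  set Y := X + p₁.eval X + p₁.eval X * (X + 1) with hY
  set b := build (fun a n => c a q r m n) with hb
  have hbq : ∀ n i, b n i ≤ q := by
    intro n
    induction n with
    | zero => intro i; exact Nat.zero_le q
    | succ n ih =>
      intro i
      change Function.update (b n) n _ i ≤ q
      rw [Function.update_apply]
      split_ifs
      · exact hcq _ _ _ _ _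
      · exact ih i
  let s₃ := (s₂.setVar 3 0).setVar 5 1
  obtain ⟨s₄, n₄, hr₄, hn₄, hI, -, -, hI2, -, -, -⟩ := exists_runs_loop (x := 3) (y := 4)
    (P := .seq P₃ (.seq (.store 0 3 6) (.add 3 3 5)))
    (fun i u => u.arr 0 = b i ∧ u.var 0 = q ∧ u.var 1 = r ∧ u.var 2 = m ∧ u.var 3 = i ∧
      u.var 4 = B ∧ u.var 5 = 1) B (p₃.eval Y + 2)
    (by
      rintro i hi u ⟨ha, h0, h1, h2, h3, h4, h5⟩
      obtain ⟨-, u', n, hr, hn, harr, h6, hy⟩ := hP₃ u Y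
        (fun j => by rw [ha]; exact (hbq i j).trans (by omega)) (fun x => by
          have : ∀ y < 4, u.var y ≤ Y := by
            intro y hy
            interval_cases y <;> omega
          exact this _ (by split_ifs <;> omega))
      replace h6 : u'.var 6 = c (b i) q r m i := by
        rw [h6]; simp [ha, h0, h1, h2, h3]
      refine ⟨by omega, _, _, .seq hr (.seq (.store _ _ _ _) (.add _ _ _ _)), by omega, ?_⟩
      simp only [Store.setVar, Store.setArr, Function.update_self]
      refine ⟨?_, ?_⟩
      · rw [hy 3 (by omega), h3, h6, harr, ha]
        rfl
      · simp [hy, h0, h1, h2, h3, h4, h5])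
    (by rintro u ⟨-, -, -, -, h3, h4, -⟩; omega) s₃ (by
      refine ⟨?_, ?_⟩
      · change s₂.arr 0 = _
        rw [harr₂, harr₁]
        rfl
      · simp [s₃, Store.setVar, hy₂, h0, h1, h2₁, h4₂])
  have hBT : B * (p₃.eval Y + 2 + 1) ≤ p₁.eval X * (X + 1) * (p₃.eval Y + 3) :=
    Nat.mul_le_mul_right _ hBle
  refine ⟨_, _, .seq hr₁ (.seq hr₂ (.seq (.const _ _ _) (.seq (.const _ _ _) (.seq hr₄
    (.seq (.const _ _ _) (.add _ _ _ _)))))), ?_, ?_, ?_⟩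
  · simp only [Polynomial.eval_add, Polynomial.eval_mul, Polynomial.eval_comp, Polynomial.eval_X,
      Polynomial.eval_ofNat, Polynomial.eval_one]
    rw [← hY]
    omega
  · simp [Store.setVar, hI2]
  · exact hI

end Greedy

/-! ### The number of sets -/

namespace Greedy

open Finset

theorem lt_numSets_iff {t r q c : ℕ} (ht : 3 ≤ t) :
    c < numSets t r q ↔
      c ^ (t - 1) * ((2 * t ^ 2) ^ (t - 1) * (r + 1) ^ (2 * t)) < q ^ t := by
  have ht1 : (t : ℝ) - 1 ≠ 0 := by
    have : (3 : ℝ) ≤ t := by exact_mod_cast ht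
    linarith
  have hcast : ((t - 1 : ℕ) : ℝ) = (t : ℝ) - 1 := by
    rw [Nat.cast_sub (by omega), Nat.cast_one]
  have hpow : ∀ x : ℝ, 0 ≤ x → ∀ y : ℝ, (x ^ y) ^ (t - 1) = x ^ (y * ((t : ℝ) - 1)) := by
    intro x hx y
    rw [← Real.rpow_natCast, ← Real.rpow_mul hx, hcast]
  have hq : ((q : ℝ) ^ (1 + 1 / ((t : ℝ) - 1))) ^ (t - 1) = (q : ℝ) ^ t := by
    rw [hpow _ q.cast_nonneg, ← Real.rpow_natCast]
    congr 1
    field_simp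
    ring
  have hr : (((r : ℝ) + 1) ^ (2 + 2 / ((t : ℝ) - 1))) ^ (t - 1) = ((r : ℝ) + 1) ^ (2 * t) := by
    rw [hpow _ (by positivity), ← Real.rpow_natCast]
    congr 1
    push_cast
    field_simp
    ring
  have ht0 : (0 : ℝ) < t := by exact_mod_cast (by omega : 0 < t)
  rw [numSets, Nat.lt_ceil, lt_div_iff₀ (by positivity),
    ← pow_lt_pow_iff_left₀ (by positivity) (by positivity) (by omega : t - 1 ≠ 0), mul_pow,
    mul_pow _ _ (t - 1), hq, hr]
  exact_mod_cast Iff.rfl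

theorem count_eq_numSets {t r q : ℕ} (ht : 3 ≤ t) (hq : 0 < q) : count t q r = numSets t r q := by
  have hle : numSets t r q ≤ q ^ 2 := by
    by_contra! h
    rw [lt_numSets_iff ht] at h
    refine absurd h (not_lt.2 ?_)
    calc q ^ t ≤ q ^ (2 * (t - 1)) := Nat.pow_le_pow_right hq (by omega)
      _ = (q ^ 2) ^ (t - 1) := pow_mul _ _ _
      _ ≤ _ := Nat.le_mul_of_pos_right _ (by positivity)
  rw [count, ← card_range (numSets t r q)]
  congr 1
  ext c
  rw [mem_filter, mem_range, mem_range, ← lt_numSets_iff ht]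
  exact ⟨fun h => h.2, fun h => ⟨h.trans_le hle, h⟩⟩

end Greedy

theorem mainTheorem6 (t : ℕ) (ht : 3 ≤ t) :
    ∃ (P : RAM.Prog) (C : ℕ) (p : Polynomial ℕ),
      ∀ r q : ℕ, 1 ≤ r → C * (r + 1) ^ 2 ≤ q →
        ∃ (s : RAM.Store) (n : ℕ),
          RAM.Runs P (RAM.input q r) s n ∧
          n ≤ p.eval q ∧
          s.var 0 = numSets t r q ∧
          IsGoodFamily t r q (numSets t r q)
            (fun i => RAM.outputSet s (r + 1) (i : ℕ)) := by
  classical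
  obtain ⟨P, p, hP⟩ := Greedy.exists_prog_build (Greedy.comp_count t) (Greedy.comp_choice t)
    (fun a q r m n => Nat.findGreatest_le q)
  refine ⟨P, 2, p.comp (2 * Polynomial.X), fun r q _ hq => ?_⟩
  have hrq : 2 * (r + 1) ≤ q := by nlinarith
  obtain ⟨s, n, hrun, hn, hs, harr⟩ := hP q r
  rw [Greedy.count_eq_numSets ht (by omega)] at hs harr
  set m := numSets t r q with hm
  refine ⟨s, n, hrun, ?_, hs, ?_⟩
  · refine hn.trans ?_
    simp only [Polynomial.eval_comp, Polynomial.eval_mul, Polynomial.eval_X,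
      Polynomial.eval_ofNat]
    exact Greedy.monotone_eval_nat p (by omega)
  · have hm0 : 0 < m := (Greedy.lt_numSets_iff ht).2 (by
      rw [zero_pow (by omega), zero_mul]
      exact Nat.pow_pos (by omega))
    refine Greedy.isGoodFamily_block (a := s.arr 0) fun n => ?_
    induction n using Nat.strong_induction_on with
    | _ n ih =>
      intro hn
      obtain ⟨v, hv⟩ := Greedy.exists_admissible ht hrq
        ((Greedy.lt_numSets_iff ht).1 (Nat.sub_lt hm0 one_pos)) hn
        fun p hp => ih p hp (hp.trans hn)
      -- The element at position `n` was chosen when only the cells below `n` had been written.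
      have hagree : ∀ p < n, Greedy.build (fun a i => Greedy.choice t a q r m i) n p = s.arr 0 p :=
        fun p hp => by rw [harr, Greedy.build_eq hp, Greedy.build_eq (hp.trans hn)]
      have hchoice : s.arr 0 n =
          Greedy.choice t (Greedy.build (fun a i => Greedy.choice t a q r m i) n) q r m n := by
        rw [harr, Greedy.build_eq hn]
      rw [← Greedy.admissible_congr hagree, hchoice]
      exact Nat.findGreatest_spec hv.le ((Greedy.admissible_congr hagree).2 hv)
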